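/- Let $d\ge 0$. A lattice polytope in $\mathbb R^d$ is the convex hull of finitely many points of $\mathbb Z^d$, and for an integer $t\ge 1$ we write $tP=\{tx : x\in P\}$. For a lattice polytope $P\subset\mathbb R^d$, let $L(P)$ be the largest number of lattice polytopes of positive dimension whose Minkowski sum is contained in $P$, and, for $1\le n\le d$, let $L_n(P)$ be the largest number of lattice polytopes of positive dimension whose Minkowski sum is at most $n$-dimensional and is contained in $P$ (these numbers are $0$ if there are no such polytopes). Put $$\lambda(P)=\sup_{t\ge 1}\frac{L(tP)}{t},\qquad \lambda_n(P)=\sup_{t\ge 1}\frac{L_n(tP)}{t},$$ where $t$ runs over the positive integers. Theorem. Let $P\subset\mathbb R^d$ be a lattice polytope. Then the numbers $L(tP)$, $L_n(tP)$ for $t \ge 1$ and the suprema $\lambda(P)$, $\lambda_n(P)$ are finite, and there is an integer $k\ge 1$ with $$\lambda(P)=\frac{L(kP)}{k}.$$ Likewise, for every $1\le n\le d$ there is an integer $k_n\ge 1$ with $$\lambda_n(P)=\frac{L_n(k_nP)}{k_n}.$$ In particular, $\lambda(P)$ and all $\lambda_n(P)$ are rational numbers. -/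

import Mathlib

open scoped Pointwise

namespace MinkowskiLength

/-- A lattice polytope in `ℝ^d`: the convex hull of finitely many points of `ℤ^d`. -/
def IsLatticePolytope {d : ℕ} (P : Set (Fin d → ℝ)) : Prop :=
  ∃ S : Finset (Fin d → ℤ),
    P = convexHull ℝ ((fun (z : Fin d → ℤ) (i : Fin d) => (z i : ℝ)) '' (S : Set (Fin d → ℤ)))

/-- The dimension of a subset of `ℝ^d`: the dimension of (the direction of) its affine span. -/
noncomputable def dimension {d : ℕ} (P : Set (Fin d → ℝ)) : ℕ :=
  Module.finrank ℝ (vectorSpan ℝ P)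

/-- The numbers `m` for which there are `m` lattice polytopes of positive dimension whose
Minkowski sum is contained in `P`. -/
def decompositionCounts {d : ℕ} (P : Set (Fin d → ℝ)) : Set ℕ :=
  {m | ∃ Q : Fin m → Set (Fin d → ℝ),
    (∀ i, IsLatticePolytope (Q i) ∧ 0 < dimension (Q i)) ∧ ∑ i, Q i ⊆ P}

/-- The numbers `m` for which there are `m` lattice polytopes of positive dimension whose
Minkowski sum is at most `n`-dimensional and is contained in `P`. -/
def decompositionCountsOfDim {d : ℕ} (n : ℕ) (P : Set (Fin d → ℝ)) : Set ℕ :=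
  {m | ∃ Q : Fin m → Set (Fin d → ℝ),
    (∀ i, IsLatticePolytope (Q i) ∧ 0 < dimension (Q i)) ∧
      dimension (∑ i, Q i) ≤ n ∧ ∑ i, Q i ⊆ P}

/-- The Minkowski length `L(P)`: the largest number of lattice polytopes of positive dimension
whose Minkowski sum is contained in `P` (it is `0` if there are none). -/
noncomputable def minkowskiLength {d : ℕ} (P : Set (Fin d → ℝ)) : ℕ :=
  sSup (decompositionCounts P)

/-- The `n`-th Minkowski length `L_n(P)`: the largest number of lattice polytopes of positive
dimension whose Minkowski sum is at most `n`-dimensional and is contained in `P` (it is `0` if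
there are none). -/
noncomputable def nthMinkowskiLength {d : ℕ} (n : ℕ) (P : Set (Fin d → ℝ)) : ℕ :=
  sSup (decompositionCountsOfDim n P)

/-- The rational Minkowski length `λ(P) = sup_{t ≥ 1} L(tP) / t`. -/
noncomputable def rationalMinkowskiLength {d : ℕ} (P : Set (Fin d → ℝ)) : ℝ :=
  ⨆ t : ℕ+, (minkowskiLength ((t : ℝ) • P) : ℝ) / (t : ℝ)

/-- The `n`-th rational Minkowski length `λ_n(P) = sup_{t ≥ 1} L_n(tP) / t`. -/
noncomputable def nthRationalMinkowskiLength {d : ℕ} (n : ℕ) (P : Set (Fin d → ℝ)) : ℝ :=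
  ⨆ t : ℕ+, (nthMinkowskiLength n ((t : ℝ) • P) : ℝ) / (t : ℝ)

end MinkowskiLength

/-!
Every summand of a decomposition may be shrunk to a nonzero lattice segment, so one has to count the
segments of lattice zonotopes contained in `tP`. Replacing two directions that are congruent modulo
`2` by their midpoint, taken twice, shrinks the zonotope, so at most `2 * 2 ^ d` distinct directions
are needed. When the directions are taken from a fixed finite set, the zonotopes contained in the
dilates of `P` form a finitely generated monoid (Gordan's lemma), and the number of segments per
unit of `t` is maximal at a generator. To pass to arbitrary directions, note that the total length
of the segments is at most linear in `t`: long directions are few, so a zonotope that beats all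
those with directions in a finite set `D` uses one of finitely many short directions outside `D`.
Adding that direction to `D`, one concludes by induction on the number of directions outside `D`.
-/

namespace MinkowskiLength

section Zonotope

variable {E : Type*} [AddCommGroup E] [Module ℝ E]

/-- The zonotope `∑ v ∈ s, [0, v]` spanned by a multiset of vectors, as an additive map in `s`. -/
noncomputable def zonotope : Multiset E →+ Set E :=
  Multiset.sumAddMonoidHom.comp (Multiset.mapAddMonoidHom (segment ℝ 0))

lemma zonotope_singleton (v : E) : zonotope {v} = segment ℝ 0 v := by
  simp [zonotope]

lemma zonotope_cons (v : E) (s : Multiset E) :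
    zonotope (v ::ₘ s) = segment ℝ 0 v + zonotope s := by
  rw [← Multiset.singleton_add, map_add, zonotope_singleton]

lemma zero_mem_zonotope (s : Multiset E) : 0 ∈ zonotope s := by
  induction s using Multiset.induction with
  | empty => simp
  | cons v s ih =>
    rw [zonotope_cons]
    exact ⟨0, left_mem_segment ℝ 0 v, 0, ih, add_zero 0⟩

lemma zonotope_mono {r s : Multiset E} (h : r ≤ s) : zonotope r ⊆ zonotope s := by
  obtain ⟨t, rfl⟩ := Multiset.le_iff_exists_add.1 h
  rw [map_add]
  exact Set.subset_add_left _ (zero_mem_zonotope t)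

lemma self_mem_zonotope {v : E} {s : Multiset E} (hv : v ∈ s) : v ∈ zonotope s :=
  zonotope_mono (Multiset.singleton_le.2 hv)
    (by simpa only [zonotope_singleton] using right_mem_segment ℝ 0 v)

lemma mem_segment_zero {v x : E} : x ∈ segment ℝ 0 v ↔ ∃ θ ∈ Set.Icc (0 : ℝ) 1, θ • v = x := by
  simp [segment_eq_image']

lemma zonotope_replicate (n : ℕ) (v : E) :
    zonotope (Multiset.replicate n v) = segment ℝ 0 ((n : ℝ) • v) := by
  have smul_segment (c : ℝ) : c • segment ℝ 0 v = segment ℝ 0 (c • v) :=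
    (image_segment ℝ (LinearMap.lsmul ℝ E c).toAffineMap 0 v).trans (by simp)
  induction n with
  | zero => simpa using Set.singleton_zero.symm
  | succ n ih =>
    rw [Multiset.replicate_succ, zonotope_cons, ih, ← smul_segment, ← smul_segment, add_comm,
      Nat.cast_succ, (convex_segment 0 v).add_smul n.cast_nonneg zero_le_one, one_smul]

lemma zonotope_cons_cons_subset {u v w : E} (h : v + w = u + u) (s : Multiset E) :
    zonotope (u ::ₘ u ::ₘ s) ⊆ zonotope (v ::ₘ w ::ₘ s) := by
  -- `α u + β u = γ v + γ w` with `γ = (α + β) / 2`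
  have hpair : segment ℝ 0 u + segment ℝ 0 u ⊆ segment ℝ 0 v + segment ℝ 0 w := by
    rintro - ⟨x, hx, y, hy, rfl⟩
    obtain ⟨α, ⟨hα₀, hα₁⟩, rfl⟩ := mem_segment_zero.1 hx
    obtain ⟨β, ⟨hβ₀, hβ₁⟩, rfl⟩ := mem_segment_zero.1 hy
    have hmid : (α + β) / 2 ∈ Set.Icc (0 : ℝ) 1 := ⟨by positivity, by linarith⟩
    refine ⟨_, mem_segment_zero.2 ⟨_, hmid, rfl⟩, _, mem_segment_zero.2 ⟨_, hmid, rfl⟩, ?_⟩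
    dsimp only
    rw [← smul_add, h]
    module
  simp only [zonotope_cons, ← add_assoc]
  exact Set.add_subset_add_right hpair

lemma zonotope_subset_submodule {W : Submodule ℝ E} {s : Multiset E} (hs : ∀ v ∈ s, v ∈ W) :
    zonotope s ⊆ W := by
  induction s using Multiset.induction with
  | empty => simp
  | cons v s ih =>
    rw [Multiset.forall_mem_cons] at hs
    rw [zonotope_cons]
    rintro - ⟨x, hx, y, hy, rfl⟩
    obtain ⟨θ, -, rfl⟩ := mem_segment_zero.1 hx
    exact W.add_mem (W.smul_mem θ hs.1) (ih hs.2 hy)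

lemma vectorSpan_zonotope (s : Multiset E) :
    vectorSpan ℝ (zonotope s) = Submodule.span ℝ {v | v ∈ s} := by
  apply le_antisymm
  · rw [vectorSpan, Submodule.span_le]
    have hs : zonotope s ⊆ Submodule.span ℝ {v | v ∈ s} :=
      zonotope_subset_submodule fun v hv => Submodule.subset_span hv
    rintro - ⟨x, hx, y, hy, rfl⟩
    exact Submodule.sub_mem _ (hs hx) (hs hy)
  · refine Submodule.span_le.2 fun v hv => ?_
    simpa using vsub_mem_vectorSpan ℝ (self_mem_zonotope hv) (zero_mem_zonotope s)

lemma exists_zonotope_width (ℓ : E →ₗ[ℝ] ℝ) (s : Multiset E) :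
    ∃ x ∈ zonotope s, ∃ y ∈ zonotope s, ℓ x - ℓ y = (s.map fun v => |ℓ v|).sum := by
  induction s using Multiset.induction with
  | empty => simp
  | cons v s ih =>
    obtain ⟨x, hx, y, hy, hxy⟩ := ih
    have h0 := left_mem_segment ℝ 0 v
    have h1 := right_mem_segment ℝ 0 v
    simp only [zonotope_cons, Multiset.map_cons, Multiset.sum_cons, ← hxy]
    rcases le_total 0 (ℓ v) with hv | hv
    · refine ⟨_, Set.add_mem_add h1 hx, _, Set.add_mem_add h0 hy, ?_⟩
      simp only [map_add, map_zero, abs_of_nonneg hv]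
      ring
    · refine ⟨_, Set.add_mem_add h0 hx, _, Set.add_mem_add h1 hy, ?_⟩
      simp only [map_add, map_zero, abs_of_nonpos hv]
      ring

lemma sum_segment_eq_convexHull {ι : Type*} [Fintype ι] (w : ι → E) :
    ∑ i, segment ℝ 0 (w i) =
      convexHull ℝ (Set.range fun I : Finset ι => ∑ i ∈ I, w i) := by
  classical
  simp only [← convexHull_pair, ← convexHull_sum]
  congr 1
  ext x
  simp only [Set.mem_fintype_sum, Set.mem_range]
  constructor
  · rintro ⟨g, hg, rfl⟩
    refine ⟨Finset.univ.filter fun i => g i = w i, ?_⟩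
    rw [Finset.sum_filter]
    refine Finset.sum_congr rfl fun i _ => ?_
    rcases hg i with h | h <;> split_ifs <;> simp_all
  · rintro ⟨I, rfl⟩
    refine ⟨fun i => if i ∈ I then w i else 0, fun i => ?_, by simp⟩
    by_cases hi : i ∈ I <;> simp [hi]

lemma vadd_sum_segment_subset_iff {ι : Type*} [Fintype ι] {Q : Set E} (hQ : Convex ℝ Q) (a : E)
    (w : ι → E) :
    a +ᵥ ∑ i, segment ℝ 0 (w i) ⊆ Q ↔ ∀ I : Finset ι, a + ∑ i ∈ I, w i ∈ Q := by
  rw [sum_segment_eq_convexHull, ← convexHull_vadd, hQ.convexHull_subset_iff,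
    Set.vadd_set_subset_iff]
  simp

end Zonotope

section FewDirections

variable {d : ℕ}

/-- The inclusion of the lattice `ℤ^d` in `ℝ^d`. -/
def latticeEmb (d : ℕ) : (Fin d → ℤ) →+ (Fin d → ℝ) := (Int.castAddHom ℝ).compLeft (Fin d)

lemma latticeEmb_apply (z : Fin d → ℤ) (i : Fin d) : latticeEmb d z i = z i := rfl

lemma latticeEmb_injective (d : ℕ) : Function.Injective (latticeEmb d) := fun x y h => by
  ext i
  exact Int.cast_injective (congrFun h i)

/-- The zonotope in `ℝ^d` spanned by a multiset of lattice vectors. -/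
noncomputable def latticeZonotope (s : Multiset (Fin d → ℤ)) : Set (Fin d → ℝ) :=
  zonotope (s.map (latticeEmb d))

lemma latticeZonotope_zero : latticeZonotope (0 : Multiset (Fin d → ℤ)) = {0} := by
  simpa [latticeZonotope] using Set.singleton_zero.symm

lemma latticeZonotope_mono {r s : Multiset (Fin d → ℤ)} (h : r ≤ s) :
    latticeZonotope r ⊆ latticeZonotope s :=
  zonotope_mono (Multiset.map_le_map h)

lemma exists_halfway_of_mod_two_eq {v w : Fin d → ℤ}
    (h : (fun i => (v i : ZMod 2)) = fun i => (w i : ZMod 2)) : ∃ u, v + w = u + u := by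
  refine ⟨fun i => (v i + w i) / 2, funext fun i => ?_⟩
  have hi := (ZMod.intCast_eq_intCast_iff_dvd_sub _ _ _).1 (congrFun h i)
  simp only [Pi.add_apply]
  push_cast at hi
  omega

/-- Three elements in one class modulo `2` are needed, since two of them may be opposite. -/
lemma exists_halfway_of_card_lt {D : Finset (Fin d → ℤ)} (hD : 2 * 2 ^ d < D.card) :
    ∃ v ∈ D, ∃ w ∈ D, v ≠ w ∧ ∃ u ≠ 0, v + w = u + u := by
  classical
  obtain ⟨y, -, hy⟩ := Finset.exists_lt_card_fiber_of_mul_lt_card_of_maps_to (s := D)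
    (t := (Finset.univ : Finset (Fin d → ZMod 2))) (f := fun v i => (v i : ZMod 2)) (n := 2)
    (fun _ _ => Finset.mem_univ _) (by simpa [ZMod.card, mul_comm] using hD)
  obtain ⟨v, hv, w, hw, z, hz, hvw, hvz, hwz⟩ := Finset.two_lt_card.1 hy
  rw [Finset.mem_filter] at hv hw hz
  obtain ⟨u, hu⟩ := exists_halfway_of_mod_two_eq (hv.2.trans hw.2.symm)
  obtain ⟨u', hu'⟩ := exists_halfway_of_mod_two_eq (hv.2.trans hz.2.symm)
  rcases eq_or_ne u 0 with rfl | h0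
  · refine ⟨v, hv.1, z, hz.1, hvz, u', ?_, hu'⟩
    rintro rfl
    exact hwz (add_left_cancel (hu.trans hu'.symm))
  · exact ⟨v, hv.1, w, hw.1, hvw, u, h0, hu⟩

/-- The squared Euclidean norm, the measure of descent when two directions are replaced by their
midpoint. -/
def normSq (v : Fin d → ℤ) : ℕ := ∑ i, (v i).natAbs ^ 2

lemma normSq_add_normSq_lt {u v w : Fin d → ℤ} (h : v + w = u + u) (hvw : v ≠ w) :
    normSq u + normSq u < normSq v + normSq w := by
  have hi (i) : v i + w i = u i + u i := congrFun h i
  have parallelogram (i) :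
      v i ^ 2 + w i ^ 2 = u i ^ 2 + u i ^ 2 + 2 * (v i - u i) ^ 2 := by
    rw [show w i = 2 * u i - v i by linarith [hi i]]
    ring
  simp only [normSq, ← Finset.sum_add_distrib]
  zify
  simp only [sq_abs]
  refine Finset.sum_lt_sum (fun i _ => ?_) ?_
  · nlinarith [parallelogram i, sq_nonneg (v i - u i)]
  · obtain ⟨i, hne⟩ := Function.ne_iff.1 hvw
    have hvu : v i - u i ≠ 0 := fun h0 => hne (by linarith [hi i])
    exact ⟨i, Finset.mem_univ i, by linarith [parallelogram i, sq_pos_of_ne_zero hvu]⟩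

theorem exists_latticeZonotope_few_directions (s : Multiset (Fin d → ℤ)) (h0 : 0 ∉ s) :
    ∃ s' : Multiset (Fin d → ℤ), s'.card = s.card ∧ 0 ∉ s' ∧
      latticeZonotope s' ⊆ latticeZonotope s ∧ s'.toFinset.card ≤ 2 * 2 ^ d := by
  induction hN : (s.map normSq).sum using Nat.strong_induction_on generalizing s with
  | _ N ih =>
    by_cases hs : s.toFinset.card ≤ 2 * 2 ^ d
    · exact ⟨s, rfl, h0, subset_rfl, hs⟩
    obtain ⟨v, hv, w, hw, hvw, u, hu0, hu⟩ := exists_halfway_of_card_lt (not_le.1 hs)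
    rw [Multiset.mem_toFinset] at hv hw
    obtain ⟨s₁, rfl⟩ := Multiset.exists_cons_of_mem hv
    obtain ⟨r, rfl⟩ := Multiset.exists_cons_of_mem
      ((Multiset.mem_cons.1 hw).resolve_left hvw.symm)
    have hdescent : ((u ::ₘ u ::ₘ r).map normSq).sum < N := by
      have := normSq_add_normSq_lt hu hvw
      simp only [Multiset.map_cons, Multiset.sum_cons] at hN ⊢
      omega
    have hsub : latticeZonotope (u ::ₘ u ::ₘ r) ⊆ latticeZonotope (v ::ₘ w ::ₘ r) := by
      simp only [latticeZonotope, Multiset.map_cons]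
      exact zonotope_cons_cons_subset (by simp only [← map_add, hu]) _
    have hr : 0 ∉ u ::ₘ u ::ₘ r := by
      simp only [Multiset.mem_cons, not_or] at h0 ⊢
      exact ⟨hu0.symm, hu0.symm, h0.2.2⟩
    obtain ⟨s', hcard, hzero, hs', hdir⟩ := ih _ hdescent _ hr rfl
    exact ⟨s', by simpa using hcard, hzero, hs'.trans hsub, hdir⟩

end FewDirections

section Bounded

variable {d : ℕ} {P : Set (Fin d → ℝ)}

lemma IsLatticePolytope.convex (hP : IsLatticePolytope P) : Convex ℝ P := by
  obtain ⟨V, rfl⟩ := hP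
  exact convex_convexHull ℝ _

lemma IsLatticePolytope.isBounded (hP : IsLatticePolytope P) : Bornology.IsBounded P := by
  obtain ⟨V, rfl⟩ := hP
  exact isBounded_convexHull.2 (V.finite_toSet.image _).isBounded

lemma IsLatticePolytope.exists_latticeEmb_mem (hP : IsLatticePolytope P) (hne : P.Nonempty) :
    ∃ a, latticeEmb d a ∈ P := by
  obtain ⟨V, rfl⟩ := hP
  obtain ⟨-, a, ha, rfl⟩ := convexHull_nonempty_iff.1 hne
  exact ⟨a, subset_convexHull ℝ _ (Set.mem_image_of_mem _ ha)⟩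

lemma norm_latticeEmb (v : Fin d → ℤ) : ‖latticeEmb d v‖ = ‖v‖ := by
  have hcoord (i) : ‖(v i : ℝ)‖₊ = ‖v i‖₊ := NNReal.eq (Int.norm_cast_real _)
  simp only [Pi.norm_def, latticeEmb_apply, hcoord]

lemma one_le_norm {v : Fin d → ℤ} (hv : v ≠ 0) : 1 ≤ ‖v‖ := by
  obtain ⟨i, hi⟩ := Function.ne_iff.1 hv
  refine le_trans ?_ (norm_le_pi_norm v i)
  rw [Int.norm_eq_abs]
  exact_mod_cast Int.one_le_abs hi

lemma finite_norm_le (d : ℕ) (B : ℝ) : {v : Fin d → ℤ | ‖v‖ ≤ B}.Finite := by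
  simpa [Metric.closedBall] using
    (isCompact_closedBall (0 : Fin d → ℤ) B).finite_of_discrete

lemma norm_le_sum_abs (v : Fin d → ℤ) : ‖v‖ ≤ ∑ i, |(v i : ℝ)| :=
  (pi_norm_le_iff_of_nonneg (Finset.sum_nonneg fun _ _ => abs_nonneg _)).2 fun i =>
    Finset.single_le_sum (f := fun i => |(v i : ℝ)|) (fun _ _ => abs_nonneg _) (Finset.mem_univ i)

lemma card_mul_le_sum_norm {B : ℝ} {s : Multiset (Fin d → ℤ)} (hs : ∀ v ∈ s, B ≤ ‖v‖) :
    s.card * B ≤ (s.map fun v => ‖v‖).sum := by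
  simpa using Multiset.card_nsmul_le_sum (s := s.map fun v => ‖v‖) (a := B) (by simpa using hs)

/-- `Fits P c` says that, for `c = (t, s)`, some lattice translate of the zonotope of `s` is
contained in the dilate `tP`. -/
def Fits (P : Set (Fin d → ℝ)) (c : ℕ × Multiset (Fin d → ℤ)) : Prop :=
  ∃ a, latticeEmb d a +ᵥ latticeZonotope c.2 ⊆ (c.1 : ℝ) • P

lemma Fits.mono {t : ℕ} {r s : Multiset (Fin d → ℤ)} (h : Fits P (t, s))
    (hrs : latticeZonotope r ⊆ latticeZonotope s) : Fits P (t, r) :=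
  h.imp fun _ ha => (Set.vadd_set_mono hrs).trans ha

lemma Fits.nonempty {c : ℕ × Multiset (Fin d → ℤ)} (h : Fits P c) : P.Nonempty := by
  obtain ⟨a, ha⟩ := h
  obtain ⟨p, hp, -⟩ := ha (Set.vadd_mem_vadd_set (zero_mem_zonotope _))
  exact ⟨p, hp⟩

/-- The width of the zonotope of `s` in the `i`-th coordinate direction is `∑ v ∈ s, |v i|`. -/
lemma exists_sum_norm_le (hP : Bornology.IsBounded P) :
    ∃ C ≥ 0, ∀ c, Fits P c → (c.2.map fun v => ‖v‖).sum ≤ C * c.1 := by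
  obtain ⟨b, hb0, hb⟩ := hP.exists_pos_norm_le
  refine ⟨d * (2 * b), by positivity, fun ⟨t, s⟩ ⟨a, ha⟩ => ?_⟩
  have hnorm : ∀ x ∈ latticeZonotope s, ‖latticeEmb d a + x‖ ≤ t * b := fun x hx => by
    obtain ⟨p, hp, hpx⟩ := ha (Set.vadd_mem_vadd_set hx)
    rw [← vadd_eq_add, ← hpx, norm_smul, Real.norm_natCast]
    exact mul_le_mul_of_nonneg_left (hb p hp) t.cast_nonneg
  have hwidth : ∀ i, (s.map fun v => |(v i : ℝ)|).sum ≤ 2 * b * t := fun i => by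
    obtain ⟨x, hx, y, hy, hxy⟩ :=
      exists_zonotope_width (LinearMap.proj i) (s.map (latticeEmb d))
    have hxi := (norm_le_pi_norm _ i).trans (hnorm x hx)
    have hyi := (norm_le_pi_norm _ i).trans (hnorm y hy)
    simp only [Pi.add_apply, Real.norm_eq_abs, abs_le] at hxi hyi
    simp only [LinearMap.proj_apply, Multiset.map_map] at hxy
    change _ = (s.map fun v => |(v i : ℝ)|).sum at hxy
    linarith
  calc (s.map fun v => ‖v‖).sum ≤ (s.map fun v => ∑ i, |(v i : ℝ)|).sum :=
        Multiset.sum_map_le_sum_map _ _ fun v _ => norm_le_sum_abs v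
    _ = ∑ i, (s.map fun v => |(v i : ℝ)|).sum := Multiset.sum_map_sum_map _ _
    _ ≤ ∑ _i : Fin d, 2 * b * t := Finset.sum_le_sum fun i _ => hwidth i
    _ = d * (2 * b) * t := by simp [mul_assoc]

lemma exists_card_le (hP : Bornology.IsBounded P) :
    ∃ C : ℝ, ∀ c, Fits P c → 0 ∉ c.2 → (c.2.card : ℝ) ≤ C * c.1 := by
  obtain ⟨C, -, hC⟩ := exists_sum_norm_le hP
  refine ⟨C, fun c hc h0 => le_trans ?_ (hC c hc)⟩
  have hone : ∀ v ∈ c.2, 1 ≤ ‖v‖ := fun v hv => one_le_norm fun hv0 => h0 (hv0 ▸ hv)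
  simpa using card_mul_le_sum_norm hone

end Bounded

section Gordan

theorem fg_comap {M N : Type*} [AddCommMonoid M] [AddCommMonoid N] [IsCancelAdd N]
    [AddMonoid.FG M] (f : M →+ N) {S : AddSubmonoid N} (hS : S.FG) : (S.comap f).FG := by
  obtain ⟨m, h, hh⟩ := AddSubmonoid.fg_iff_exists_fin_addMonoidHom.1 (AddMonoid.FG.fg_top (M := M))
  obtain ⟨n, g, rfl⟩ := AddSubmonoid.fg_iff_exists_fin_addMonoidHom.1 hS
  have hfiber := AddSubmonoid.fg_eqLocusM ((f.comp h).comp (AddMonoidHom.fst _ _))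
    (g.comp (AddMonoidHom.snd (Fin m → ℕ) (Fin n → ℕ)))
  convert hfiber.map (h.comp (AddMonoidHom.fst _ _)) using 1
  ext x
  obtain ⟨y, rfl⟩ : x ∈ AddMonoidHom.mrange h := hh ▸ AddSubmonoid.mem_top x
  simp only [AddSubmonoid.mem_comap, AddMonoidHom.mem_mrange, AddSubmonoid.mem_map]
  constructor
  · rintro ⟨z, hz⟩
    exact ⟨(y, z), hz.symm, rfl⟩
  · rintro ⟨⟨y', z⟩, hz, hy'⟩
    exact ⟨z, hz.symm.trans (congrArg f hy')⟩

theorem exists_max_ratio_of_fg {M : Type*} [AddCommMonoid M] {S : AddSubmonoid M} (hS : S.FG)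
    (f g : M →+ ℕ) (hfg : ∀ x ∈ S, g x = 0 → f x = 0) (hpos : ∃ x ∈ S, 0 < g x) :
    ∃ x ∈ S, 0 < g x ∧ ∀ y ∈ S, f y * g x ≤ f x * g y := by
  obtain ⟨T, rfl⟩ := hS
  have hT : ∀ x ∈ T, x ∈ AddSubmonoid.closure (T : Set M) := fun x hx =>
    AddSubmonoid.subset_closure hx
  have hne : (T.filter fun x => 0 < g x).Nonempty := by
    by_contra! hempty
    obtain ⟨x, hx, hgx⟩ := hpos
    have hker : AddSubmonoid.closure (T : Set M) ≤ AddMonoidHom.mker g :=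
      AddSubmonoid.closure_le.2 fun y hy => by
        simpa using Finset.filter_eq_empty_iff.1 hempty hy
    exact hgx.ne' (hker hx)
  obtain ⟨x, hx, hmax⟩ := Finset.exists_max_image _ (fun x => (f x : ℚ) / g x) hne
  rw [Finset.mem_filter] at hx
  refine ⟨x, hT x hx.1, hx.2, fun y hy => ?_⟩
  induction hy using AddSubmonoid.closure_induction with
  | zero => simp
  | add y z _ _ hy hz =>
    rw [map_add, map_add, add_mul, mul_add]
    exact add_le_add hy hz
  | mem y hy =>
    rcases (g y).eq_zero_or_pos with hgy | hgy
    · simp [hfg y (hT y hy) hgy]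
    · have hle := hmax y (Finset.mem_filter.2 ⟨hy, hgy⟩)
      rw [div_le_div_iff₀ (by exact_mod_cast hgy) (by exact_mod_cast hx.2)] at hle
      exact_mod_cast hle

lemma sum_smul_mem_smul {E ι : Type*} [AddCommGroup E] [Module ℝ E] {P : Set E}
    (hP : Convex ℝ P) (hne : P.Nonempty) {I : Finset ι} {c : ι → ℝ} {p : ι → E}
    (hc : ∀ i ∈ I, 0 ≤ c i) (hp : ∀ i ∈ I, p i ∈ P) :
    ∑ i ∈ I, c i • p i ∈ (∑ i ∈ I, c i) • P := by
  classical
  induction I using Finset.induction with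
  | empty => simp [Set.zero_smul_set hne]
  | insert i I hi ih =>
    rw [Finset.forall_mem_insert] at hc hp
    rw [Finset.sum_insert hi, Finset.sum_insert hi,
      hP.add_smul hc.1 (Finset.sum_nonneg hc.2)]
    exact Set.add_mem_add (Set.smul_mem_smul_set hp.1) (ih hc.2 hp.2)

variable {d : ℕ} {P : Set (Fin d → ℝ)}

/-- The monoid of lattice points of the cone over `{1} × P`, that is, of the pairs `(t, x)` with
`x` a lattice point of the dilate `tP`. -/
def latticeCone (hP : Convex ℝ P) (hne : P.Nonempty) : AddSubmonoid (ℕ × (Fin d → ℤ)) where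
  carrier := {c | latticeEmb d c.2 ∈ (c.1 : ℝ) • P}
  zero_mem' := by simp [Set.zero_smul_set hne]
  add_mem' {b c} hb hc := by
    simp only [Set.mem_ofPred_eq, Prod.fst_add, Prod.snd_add, map_add, Nat.cast_add] at hb hc ⊢
    rw [hP.add_smul b.1.cast_nonneg c.1.cast_nonneg]
    exact Set.add_mem_add hb hc

lemma mem_latticeCone {hP : Convex ℝ P} {hne : P.Nonempty} {c : ℕ × (Fin d → ℤ)} :
    c ∈ latticeCone hP hne ↔ latticeEmb d c.2 ∈ (c.1 : ℝ) • P := Iff.rfl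

lemma finite_latticeCone_fst_le (hP : Convex ℝ P) (hne : P.Nonempty)
    (hb : Bornology.IsBounded P) (N : ℕ) : {c | c ∈ latticeCone hP hne ∧ c.1 ≤ N}.Finite := by
  obtain ⟨b, hb⟩ := hb.exists_norm_le
  refine ((Set.finite_Iic N).prod (finite_norm_le d (N * b))).subset fun c ⟨hc, hN⟩ => ⟨hN, ?_⟩
  obtain ⟨p, hp, hpc⟩ := mem_latticeCone.1 hc
  have hcN : (c.1 : ℝ) ≤ N := by exact_mod_cast hN
  calc ‖c.2‖ = c.1 * ‖p‖ := by
        rw [← norm_latticeEmb, ← hpc, norm_smul, Real.norm_natCast]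
    _ ≤ N * b := mul_le_mul hcN (hb p hp) (norm_nonneg p) N.cast_nonneg

lemma exists_weights_of_mem_smul_convexHull {V : Finset (Fin d → ℤ)} {t : ℝ} (ht : 0 ≤ t)
    {x : Fin d → ℝ} (hx : x ∈ t • convexHull ℝ (latticeEmb d '' V)) :
    ∃ c : (Fin d → ℤ) → ℝ, (∀ v ∈ V, 0 ≤ c v) ∧ ∑ v ∈ V, c v = t ∧
      ∑ v ∈ V, c v • latticeEmb d v = x := by
  classical
  obtain ⟨y, hy, rfl⟩ := hx
  rw [← Finset.coe_image, Finset.mem_convexHull'] at hy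
  obtain ⟨w, hw0, hw1, rfl⟩ := hy
  rw [Finset.sum_image (latticeEmb_injective d).injOn] at hw1
  rw [Finset.sum_image (latticeEmb_injective d).injOn]
  refine ⟨fun v => t * w (latticeEmb d v), fun v hv => ?_, ?_, ?_⟩
  · exact mul_nonneg ht (hw0 _ (Finset.mem_image_of_mem _ hv))
  · rw [← Finset.mul_sum, hw1, mul_one]
  · simp only [mul_smul, Finset.smul_sum]

/-- Split the weights of `(t, x)` into integral and fractional parts. -/
lemma exists_latticeCone_remainder {V : Finset (Fin d → ℤ)}
    (hP : P = convexHull ℝ (latticeEmb d '' V)) {hconv : Convex ℝ P} {hne : P.Nonempty}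
    {c : ℕ × (Fin d → ℤ)} (hc : c ∈ latticeCone hconv hne) :
    ∃ r ∈ latticeCone hconv hne, r.1 ≤ V.card ∧
      ∃ n : (Fin d → ℤ) → ℕ, c = r + ∑ v ∈ V, n v • (1, v) := by
  obtain ⟨t, x⟩ := c
  obtain ⟨c, hc0, hct, hcx⟩ :=
    exists_weights_of_mem_smul_convexHull t.cast_nonneg (hP ▸ mem_latticeCone.1 hc)
  have hfloor_le : ∀ v ∈ V, (⌊c v⌋₊ : ℝ) ≤ c v := fun v hv => Nat.floor_le (hc0 v hv)
  have hfloor : ∑ v ∈ V, ⌊c v⌋₊ ≤ t := by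
    have : ∑ v ∈ V, (⌊c v⌋₊ : ℝ) ≤ t := hct ▸ Finset.sum_le_sum hfloor_le
    exact_mod_cast this
  have hfract : ((t - ∑ v ∈ V, ⌊c v⌋₊ : ℕ) : ℝ) = ∑ v ∈ V, (c v - ⌊c v⌋₊) := by
    rw [Nat.cast_sub hfloor, Finset.sum_sub_distrib, hct, Nat.cast_sum]
  refine ⟨(t - ∑ v ∈ V, ⌊c v⌋₊, x - ∑ v ∈ V, ⌊c v⌋₊ • v), ?_, ?_, fun v => ⌊c v⌋₊, ?_⟩
  · rw [mem_latticeCone, hfract]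
    convert sum_smul_mem_smul hconv hne (fun v hv => sub_nonneg.2 (hfloor_le v hv))
      (fun v hv => hP ▸ subset_convexHull ℝ _ (Set.mem_image_of_mem _ hv)) using 1
    simp only [map_sub, map_sum, map_nsmul, sub_smul, Finset.sum_sub_distrib, hcx,
      Nat.cast_smul_eq_nsmul]
  · have : ((t - ∑ v ∈ V, ⌊c v⌋₊ : ℕ) : ℝ) ≤ V.card := by
      rw [hfract, ← nsmul_one]
      exact Finset.sum_le_card_nsmul _ _ _ fun v _ => by linarith [Nat.lt_floor_add_one (c v)]
    exact_mod_cast this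
  · ext1
    · simp [Prod.fst_sum, hfloor]
    · simp [Prod.snd_sum]

theorem latticeCone_fg (hP : IsLatticePolytope P) (hne : P.Nonempty) :
    (latticeCone hP.convex hne).FG := by
  obtain ⟨V, hV⟩ := id hP
  set G := {c | c ∈ latticeCone hP.convex hne ∧ c.1 ≤ V.card}
  refine (AddSubmonoid.fg_iff _).2
    ⟨G, le_antisymm (AddSubmonoid.closure_le.2 fun c hc => hc.1) fun c hc => ?_,
      finite_latticeCone_fst_le hP.convex hne hP.isBounded _⟩
  obtain ⟨r, hr, hrV, n, rfl⟩ := exists_latticeCone_remainder hV hc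
  have hvertex : ∀ v ∈ V, (1, v) ∈ G := fun v hv => by
    have hvP : latticeEmb d v ∈ P := hV ▸ subset_convexHull ℝ _ (Set.mem_image_of_mem _ hv)
    exact ⟨by simpa [mem_latticeCone] using hvP, Finset.card_pos.2 ⟨v, hv⟩⟩
  exact add_mem (AddSubmonoid.subset_closure ⟨hr, hrV⟩)
    (sum_mem fun v hv => nsmul_mem (AddSubmonoid.subset_closure (hvertex v hv)) _)

end Gordan

section FixedDirections

variable {d : ℕ} {P : Set (Fin d → ℝ)} {D : Finset (Fin d → ℤ)}

/-- The multiset of elements of `D` with prescribed multiplicities. -/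
def ofCounts (m : D → ℕ) : Multiset (Fin d → ℤ) := ∑ u, Multiset.replicate (m u) u.1

lemma card_ofCounts (m : D → ℕ) : (ofCounts m).card = ∑ u, m u := by
  simp [ofCounts]

lemma mem_of_mem_ofCounts {m : D → ℕ} {v : Fin d → ℤ} (hv : v ∈ ofCounts m) : v ∈ D := by
  obtain ⟨u, -, hu⟩ := Multiset.mem_sum.1 hv
  exact Multiset.eq_of_mem_replicate hu ▸ u.2

lemma exists_ofCounts_eq {s : Multiset (Fin d → ℤ)} (hs : s.toFinset ⊆ D) :
    ∃ m : D → ℕ, ofCounts m = s := by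
  refine ⟨fun u => s.count u.1, ?_⟩
  simp only [ofCounts, ← Multiset.nsmul_singleton]
  rw [Finset.sum_coe_sort D fun u => s.count u • ({u} : Multiset (Fin d → ℤ)),
    ← Finset.sum_subset hs fun u _ hu => ?_, Multiset.toFinset_sum_count_nsmul_eq]
  rw [Multiset.count_eq_zero.2 (mt Multiset.mem_toFinset.2 hu), zero_nsmul]

lemma latticeZonotope_ofCounts (m : D → ℕ) :
    latticeZonotope (ofCounts m) = ∑ u, segment ℝ 0 (latticeEmb d (m u • u.1)) := by
  have hmap : (ofCounts m).map (latticeEmb d) =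
      ∑ u, Multiset.replicate (m u) (latticeEmb d u.1) := by
    simp only [ofCounts, ← Multiset.coe_mapAddMonoidHom, map_sum]
    simp
  simp only [latticeZonotope, hmap, map_sum, zonotope_replicate, map_nsmul,
    Nat.cast_smul_eq_nsmul]

/-- The corners `a + ∑ u ∈ I, m u • u` of a translated zonotope, each paired with the dilation
factor `t`. -/
def corners (D : Finset (Fin d → ℤ)) :
    ℕ × (Fin d → ℤ) × (D → ℕ) →+ (Finset D → ℕ × (Fin d → ℤ)) where
  toFun c I := (c.1, c.2.1 + ∑ u ∈ I, c.2.2 u • u.1)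
  map_zero' := by
    ext <;> simp
  map_add' b c := by
    funext I
    simp only [Prod.fst_add, Prod.snd_add, Pi.add_apply, add_smul, Finset.sum_add_distrib,
      Prod.mk_add_mk, add_add_add_comm]

/-- The monoid of triples `(t, a, m)` for which the translate by `a` of the zonotope with
multiplicities `m` is contained in `tP`. -/
def zonotopeMonoid (hP : Convex ℝ P) (hne : P.Nonempty) (D : Finset (Fin d → ℤ)) :
    AddSubmonoid (ℕ × (Fin d → ℤ) × (D → ℕ)) :=
  (AddSubmonoid.pi Set.univ fun _ => latticeCone hP hne).comap (corners D)

lemma mem_zonotopeMonoid {hP : Convex ℝ P} {hne : P.Nonempty} {t : ℕ} {a : Fin d → ℤ}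
    {m : D → ℕ} : (t, a, m) ∈ zonotopeMonoid hP hne D ↔
      latticeEmb d a +ᵥ latticeZonotope (ofCounts m) ⊆ (t : ℝ) • P := by
  rw [latticeZonotope_ofCounts, vadd_sum_segment_subset_iff (hP.smul _)]
  simp [zonotopeMonoid, AddSubmonoid.mem_pi, corners, mem_latticeCone]

lemma zonotopeMonoid_fg (hP : IsLatticePolytope P) (hne : P.Nonempty)
    (D : Finset (Fin d → ℤ)) : (zonotopeMonoid hP.convex hne D).FG :=
  fg_comap _ (AddSubmonoid.FG.pi fun _ => latticeCone_fg hP hne)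

theorem exists_max_ratio_of_directions (hP : IsLatticePolytope P) (hne : P.Nonempty)
    (hD : 0 ∉ D) :
    ∃ t > 0, ∃ s, s.toFinset ⊆ D ∧ Fits P (t, s) ∧
      ∀ t' s', s'.toFinset ⊆ D → Fits P (t', s') → s'.card * t ≤ s.card * t' := by
  obtain ⟨C, hC⟩ := exists_card_le hP.isBounded
  obtain ⟨p, hp⟩ := hP.exists_latticeEmb_mem hne
  let total : ℕ × (Fin d → ℤ) × (D → ℕ) →+ ℕ :=
    (∑ u, Pi.evalAddMonoidHom (fun _ => ℕ) u).comp
      ((AddMonoidHom.snd _ _).comp (AddMonoidHom.snd _ _))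
  have total_apply (t a m) : total (t, a, m) = (ofCounts m).card := by
    simp [total, card_ofCounts]
  have hzero : ∀ c ∈ zonotopeMonoid hP.convex hne D,
      AddMonoidHom.fst _ _ c = 0 → total c = 0 := by
    rintro ⟨t, a, m⟩ hc rfl
    have hcard := hC (0, ofCounts m) ⟨a, mem_zonotopeMonoid.1 hc⟩
      fun h => hD (mem_of_mem_ofCounts h)
    rw [total_apply]
    simpa using hcard
  have hpoint : (1, p, 0) ∈ zonotopeMonoid hP.convex hne D := by
    rw [mem_zonotopeMonoid]
    simpa [ofCounts, latticeZonotope_zero] using hp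
  obtain ⟨⟨t, a, m⟩, hc, ht, hmax⟩ := exists_max_ratio_of_fg (zonotopeMonoid_fg hP hne D) total
    (AddMonoidHom.fst _ _) hzero ⟨_, hpoint, one_pos⟩
  refine ⟨t, ht, ofCounts m, fun v hv => mem_of_mem_ofCounts (Multiset.mem_toFinset.1 hv),
    ⟨a, mem_zonotopeMonoid.1 hc⟩, fun t' s' hs' ⟨a', ha'⟩ => ?_⟩
  obtain ⟨m', rfl⟩ := exists_ofCounts_eq hs'
  have hle := hmax _ (mem_zonotopeMonoid.2 ha')
  rwa [total_apply, total_apply] at hle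

end FixedDirections

section Packings

variable {d n : ℕ} {P : Set (Fin d → ℝ)} {D : Finset (Fin d → ℤ)}

lemma dimension_mono {A B : Set (Fin d → ℝ)} (h : A ⊆ B) : dimension A ≤ dimension B :=
  Submodule.finrank_mono (vectorSpan_mono ℝ h)

lemma dimension_vadd (a : Fin d → ℝ) (A : Set (Fin d → ℝ)) : dimension (a +ᵥ A) = dimension A := by
  rw [dimension, vectorSpan_vadd, dimension]

lemma vectorSpan_latticeZonotope (s : Multiset (Fin d → ℤ)) :
    vectorSpan ℝ (latticeZonotope s) = Submodule.span ℝ (latticeEmb d '' {v | v ∈ s}) :=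
  (vectorSpan_zonotope _).trans (by simp [Set.image])

lemma dimension_latticeZonotope_zero : dimension (latticeZonotope (d := d) 0) = 0 := by
  rw [latticeZonotope_zero, dimension, vectorSpan_singleton, finrank_bot]

lemma dimension_latticeZonotope_mono {r s : Multiset (Fin d → ℤ)} (h : r ⊆ s) :
    dimension (latticeZonotope r) ≤ dimension (latticeZonotope s) := by
  rw [dimension, dimension, vectorSpan_latticeZonotope, vectorSpan_latticeZonotope]
  exact Submodule.finrank_mono (Submodule.span_mono (Set.image_mono h))

/-- A pair `c = (t, s)` encodes a decomposition of a lattice zonotope of dimension at most `n`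
inside `tP` into the nonzero lattice segments `[0, v]`, `v ∈ s`. -/
structure IsPacking (n : ℕ) (P : Set (Fin d → ℝ)) (c : ℕ × Multiset (Fin d → ℤ)) : Prop where
  pos : 0 < c.1
  zero_notMem : 0 ∉ c.2
  dimension_le : dimension (latticeZonotope c.2) ≤ n
  fits : Fits P c

lemma IsPacking.mono {t : ℕ} {r s : Multiset (Fin d → ℤ)} (h : IsPacking n P (t, s)) (hr : 0 ∉ r)
    (hrs : latticeZonotope r ⊆ latticeZonotope s) : IsPacking n P (t, r) :=
  ⟨h.pos, hr, (dimension_mono hrs).trans h.dimension_le, h.fits.mono hrs⟩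

/-- The number of summands per unit of dilation. -/
noncomputable def ratio (c : ℕ × Multiset (Fin d → ℤ)) : ℝ := c.2.card / c.1

/-- The packings with at most `k` distinct directions outside `D`. -/
def packings (n : ℕ) (P : Set (Fin d → ℝ)) (D : Finset (Fin d → ℤ)) (k : ℕ) :
    Set (ℕ × Multiset (Fin d → ℤ)) :=
  {c | IsPacking n P c ∧ (c.2.toFinset \ D).card ≤ k}

lemma exists_isMaxOn_biUnion {ι α : Type*} {T : Set ι} (hT : T.Finite) (hne : T.Nonempty)
    (S : ι → Set α) (f : α → ℝ) (h : ∀ i ∈ T, ∃ x ∈ S i, IsMaxOn f (S i) x) :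
    ∃ x ∈ ⋃ i ∈ T, S i, IsMaxOn f (⋃ i ∈ T, S i) x := by
  have : Nonempty α := hne.elim fun i hi => ⟨(h i hi).choose⟩
  choose! x hxS hx using h
  obtain ⟨i, hi, hmax⟩ := Set.exists_max_image T (fun i => f (x i)) hT hne
  refine ⟨x i, Set.mem_biUnion hi (hxS i hi), fun y hy => ?_⟩
  obtain ⟨j, hj, hyj⟩ := Set.mem_iUnion₂.1 hy
  exact (hx j hj hyj).trans (hmax j hj)

lemma exists_isMaxOn_packings_zero (hP : IsLatticePolytope P) (hne : P.Nonempty)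
    (n : ℕ) (D : Finset (Fin d → ℤ)) :
    ∃ c ∈ packings n P D 0, IsMaxOn ratio (packings n P D 0) c := by
  set T := {D' | D' ⊆ D ∧ 0 ∉ D' ∧ dimension (latticeZonotope D'.val) ≤ n}
  have hT : T.Finite := D.powerset.finite_toSet.subset fun _ h => Finset.mem_powerset.2 h.1
  have hTne : T.Nonempty := ⟨∅, by simp, by simp, by simp [dimension_latticeZonotope_zero]⟩
  have hunion : packings n P D 0 =
      ⋃ D' ∈ T, {c | 0 < c.1 ∧ c.2.toFinset ⊆ D' ∧ Fits P c} := by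
    ext ⟨t, s⟩
    simp only [packings, T, Set.mem_iUnion, Set.mem_ofPred_eq, nonpos_iff_eq_zero,
      Finset.card_eq_zero, Finset.sdiff_eq_empty_iff_subset, exists_prop]
    constructor
    · rintro ⟨hc, hs⟩
      refine ⟨s.toFinset, ⟨by simpa using hs, by simpa using hc.zero_notMem, ?_⟩, hc.pos,
        subset_rfl, hc.fits⟩
      exact (dimension_latticeZonotope_mono fun v => by simp).trans hc.dimension_le
    · rintro ⟨D', ⟨hD', h0, hdim⟩, ht, hs, hfits⟩
      refine ⟨⟨ht, fun h => h0 (hs (Multiset.mem_toFinset.2 h)), ?_, hfits⟩,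
        hs.trans (by simpa using hD')⟩
      exact (dimension_latticeZonotope_mono fun v hv => hs (Multiset.mem_toFinset.2 hv)).trans hdim
  rw [hunion]
  refine exists_isMaxOn_biUnion hT hTne _ _ fun D' hD' => ?_
  obtain ⟨t, ht, s, hs, hfits, hmax⟩ := exists_max_ratio_of_directions hP hne hD'.2.1
  refine ⟨(t, s), ⟨ht, hs, hfits⟩, fun ⟨t', s'⟩ ⟨ht', hs', hfits'⟩ => ?_⟩
  change (s'.card / t' : ℝ) ≤ s.card / t
  rw [div_le_div_iff₀ (by exact_mod_cast ht') (by exact_mod_cast ht)]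
  exact_mod_cast hmax t' s' hs' hfits'

/-- Long directions are few, as the total length is linearly bounded, so dropping them all costs
little; a packing that beats all packings with directions in `D` by a margin has a short direction
outside `D`. -/
lemma exists_short_direction (hP : Bornology.IsBounded P) {q r : ℝ} (hqr : q < r)
    (hq : ∀ c ∈ packings n P D 0, ratio c ≤ q) :
    ∃ B, ∀ c, IsPacking n P c → r ≤ ratio c → ∃ v ∈ c.2.toFinset \ D, ‖v‖ ≤ B := by
  obtain ⟨C, hC0, hC⟩ := exists_sum_norm_le hP
  refine ⟨(C + 1) / (r - q), fun ⟨t, s⟩ hc hr => ?_⟩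
  by_contra! hlong
  have ht : (0 : ℝ) < t := by exact_mod_cast hc.pos
  set inner := s.filter (· ∈ D) with hinner
  set outer := s.filter (· ∉ D) with houter
  have hcard : (s.card : ℝ) = inner.card + outer.card := by
    exact_mod_cast (congrArg Multiset.card (Multiset.filter_add_not (· ∈ D) s)).symm.trans
      (Multiset.card_add _ _)
  have hinner_le : (inner.card : ℝ) ≤ q * t := by
    have hmem : (t, inner) ∈ packings n P D 0 := by
      refine ⟨hc.mono (fun h => hc.zero_notMem (Multiset.mem_of_mem_filter h))
        (latticeZonotope_mono (Multiset.filter_le _ _)), ?_⟩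
      simp [hinner, Finset.sdiff_eq_empty_iff_subset, Finset.subset_iff]
    exact (div_le_iff₀ ht).1 (hq _ hmem)
  have houter_le : outer.card * ((C + 1) / (r - q)) ≤ C * t := by
    have hnorm : ∀ v ∈ outer, (C + 1) / (r - q) ≤ ‖v‖ := fun v hv =>
      (hlong v (by simpa [houter] using hv)).le
    exact (card_mul_le_sum_norm hnorm).trans
      (hC _ (hc.fits.mono (latticeZonotope_mono (Multiset.filter_le _ _))))
  have hmargin : (r - q) * t ≤ outer.card := by
    have := (le_div_iff₀ ht).1 hr
    linarith
  have hδ : 0 < r - q := sub_pos.2 hqr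
  have : (C + 1) * t ≤ C * t := calc
    (C + 1) * t = (r - q) * t * ((C + 1) / (r - q)) := by field_simp
    _ ≤ outer.card * ((C + 1) / (r - q)) := by gcongr
    _ ≤ C * t := houter_le
  linarith

theorem exists_isMaxOn_packings (hP : IsLatticePolytope P) (hne : P.Nonempty) (n k : ℕ)
    (D : Finset (Fin d → ℤ)) : ∃ c ∈ packings n P D k, IsMaxOn ratio (packings n P D k) c := by
  induction k generalizing D with
  | zero => exact exists_isMaxOn_packings_zero hP hne n D
  | succ k ih =>
    obtain ⟨c₀, hc₀, hmax₀⟩ := exists_isMaxOn_packings_zero hP hne n D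
    by_cases hle : ∀ c ∈ packings n P D (k + 1), ratio c ≤ ratio c₀
    · exact ⟨c₀, ⟨hc₀.1, hc₀.2.trans (Nat.zero_le _)⟩, hle⟩
    push Not at hle
    obtain ⟨c₁, hc₁, hlt⟩ := hle
    obtain ⟨B, hB⟩ := exists_short_direction hP.isBounded hlt hmax₀
    set T := {v : Fin d → ℤ | ‖v‖ ≤ B} \ D
    have hT : T.Finite := (finite_norm_le d B).sdiff
    have hcover : ∀ c ∈ packings n P D (k + 1), ratio c₁ ≤ ratio c →
        c ∈ ⋃ v ∈ T, packings n P (insert v D) k := fun c hc hr => by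
      obtain ⟨v, hv, hvB⟩ := hB c hc.1 hr
      refine Set.mem_biUnion ⟨hvB, (Finset.mem_sdiff.1 hv).2⟩ ⟨hc.1, ?_⟩
      rw [Finset.sdiff_insert, Finset.card_erase_of_mem hv]
      exact Nat.sub_le_of_le_add hc.2
    have hTne : T.Nonempty := by
      obtain ⟨v, hv, -⟩ := Set.mem_iUnion₂.1 (hcover c₁ hc₁ le_rfl)
      exact ⟨v, hv⟩
    obtain ⟨c, hc, hmax⟩ := exists_isMaxOn_biUnion hT hTne _ ratio fun v _ => ih (insert v D)
    refine ⟨c, ?_, fun c' hc' => ?_⟩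
    · obtain ⟨v, -, hcv⟩ := Set.mem_iUnion₂.1 hc
      refine ⟨hcv.1, le_trans ?_ (Nat.succ_le_succ hcv.2)⟩
      rw [Finset.sdiff_insert]
      exact Nat.le_add_of_sub_le Finset.pred_card_le_card_erase
    · rcases le_total (ratio c₁) (ratio c') with hr | hr
      · exact hmax (hcover c' hc' hr)
      · exact hr.trans (hmax (hcover c₁ hc₁ le_rfl))

theorem exists_max_ratio_packing (hP : IsLatticePolytope P) (hne : P.Nonempty) (n : ℕ) :
    ∃ c, IsPacking n P c ∧ ∀ c', IsPacking n P c' → ratio c' ≤ ratio c := by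
  obtain ⟨c, hc, hmax⟩ := exists_isMaxOn_packings hP hne n (2 * 2 ^ d) ∅
  refine ⟨c, hc.1, fun ⟨t, s⟩ hs => ?_⟩
  obtain ⟨s', hcard, h0, hsub, hdir⟩ := exists_latticeZonotope_few_directions s hs.zero_notMem
  have hle : ratio (t, s') ≤ ratio c := hmax ⟨hs.mono h0 hsub, by simpa using hdir⟩
  rwa [ratio, hcard] at hle

end Packings

section Decompositions

variable {d n m : ℕ} {P Q : Set (Fin d → ℝ)}

lemma exists_map_univ_eq {α : Type*} (s : Multiset α) :
    ∃ v : Fin s.card → α, Finset.univ.val.map v = s := by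
  induction s using Quot.inductionOn with
  | h l => exact ⟨l.get, (Fin.univ_val_map l.get).trans (congrArg _ (List.ofFn_get l))⟩

lemma isLatticePolytope_vadd_segment (p v : Fin d → ℤ) :
    IsLatticePolytope (latticeEmb d p +ᵥ segment ℝ 0 (latticeEmb d v)) := by
  refine ⟨{p, p + v}, ?_⟩
  change _ = convexHull ℝ (latticeEmb d '' _)
  rw [Finset.coe_pair, Set.image_pair, convexHull_pair, vadd_segment, map_add, vadd_eq_add,
    vadd_eq_add, add_zero]

lemma dimension_vadd_segment_pos (p : Fin d → ℤ) {v : Fin d → ℤ} (hv : v ≠ 0) :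
    0 < dimension (latticeEmb d p +ᵥ segment ℝ 0 (latticeEmb d v)) := by
  have hv' : latticeEmb d v ≠ 0 := (map_ne_zero_iff _ (latticeEmb_injective d)).2 hv
  rw [dimension_vadd, dimension, vectorSpan_segment, vsub_eq_sub, sub_zero,
    finrank_span_singleton hv']
  exact one_pos

lemma IsLatticePolytope.exists_vadd_segment_subset (hQ : IsLatticePolytope Q)
    (hdim : 0 < dimension Q) :
    ∃ p v : Fin d → ℤ, v ≠ 0 ∧ latticeEmb d p +ᵥ segment ℝ 0 (latticeEmb d v) ⊆ Q := by
  obtain ⟨S, rfl⟩ := hQ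
  change 0 < dimension (convexHull ℝ (latticeEmb d '' S)) at hdim
  have hS : (S : Set (Fin d → ℤ)).Nontrivial := by
    by_contra hS
    rw [Set.not_nontrivial_iff] at hS
    rw [dimension, ← direction_affineSpan, affineSpan_convexHull, direction_affineSpan,
      vectorSpan_of_subsingleton ℝ (hS.image _), finrank_bot] at hdim
    exact hdim.false
  obtain ⟨p, hp, q, hq, hpq⟩ := hS
  refine ⟨p, q - p, sub_ne_zero.2 hpq.symm, ?_⟩
  rw [vadd_segment, ← map_zero (latticeEmb d), vadd_eq_add, vadd_eq_add, ← map_add, ← map_add,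
    add_zero, add_sub_cancel]
  exact segment_subset_convexHull (Set.mem_image_of_mem _ hp) (Set.mem_image_of_mem _ hq)

lemma sum_vadd_segment (p v : Fin m → Fin d → ℤ) :
    ∑ i, (latticeEmb d (p i) +ᵥ segment ℝ 0 (latticeEmb d (v i))) =
      latticeEmb d (∑ i, p i) +ᵥ latticeZonotope (Finset.univ.val.map v) := by
  have hzonotope : latticeZonotope (Finset.univ.val.map v) =
      ∑ i, segment ℝ 0 (latticeEmb d (v i)) := by
    simp only [latticeZonotope, zonotope, AddMonoidHom.comp_apply, Multiset.coe_sumAddMonoidHom,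
      Multiset.coe_mapAddMonoidHom, Multiset.map_map]
    rfl
  simp only [hzonotope, ← Set.singleton_vadd, vadd_eq_add, Finset.sum_add_distrib,
    Set.finsetSum_singleton, map_sum]

lemma exists_packing_of_mem_decompositionCountsOfDim {t : ℕ} (ht : 0 < t)
    (h : m ∈ decompositionCountsOfDim n ((t : ℝ) • P)) :
    ∃ s, s.card = m ∧ IsPacking n P (t, s) := by
  obtain ⟨R, hR, hdim, hsub⟩ := h
  choose p v hv hpv using fun i => (hR i).1.exists_vadd_segment_subset (hR i).2
  have hle : latticeEmb d (∑ i, p i) +ᵥ latticeZonotope (Finset.univ.val.map v) ⊆ ∑ i, R i :=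
    sum_vadd_segment p v ▸ Set.finsetSum_subset_finsetSum _ _ _ fun i _ => hpv i
  refine ⟨Finset.univ.val.map v, by simp, ht, by simpa using hv, ?_, _, hle.trans hsub⟩
  rw [← dimension_vadd]
  exact (dimension_mono hle).trans hdim

lemma IsPacking.card_mem_decompositionCountsOfDim {t : ℕ} {s : Multiset (Fin d → ℤ)}
    (h : IsPacking n P (t, s)) (hs : 0 < s.card) :
    s.card ∈ decompositionCountsOfDim n ((t : ℝ) • P) := by
  obtain ⟨-, h0 : (0 : Fin d → ℤ) ∉ s, hdim, a, ha⟩ := h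
  obtain ⟨v, hv⟩ := exists_map_univ_eq s
  let p : Fin s.card → Fin d → ℤ := Pi.single ⟨0, hs⟩ a
  have hsum : ∑ i, (latticeEmb d (p i) +ᵥ segment ℝ 0 (latticeEmb d (v i))) =
      latticeEmb d a +ᵥ latticeZonotope s := by
    rw [sum_vadd_segment, Fintype.sum_pi_single', hv]
  refine ⟨fun i => latticeEmb d (p i) +ᵥ segment ℝ 0 (latticeEmb d (v i)), fun i =>
    ⟨isLatticePolytope_vadd_segment _ _, dimension_vadd_segment_pos _ ?_⟩, ?_, ?_⟩
  · rintro hi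
    exact h0 (hv ▸ Multiset.mem_map.2 ⟨i, Finset.mem_univ i, hi⟩)
  · rw [hsum, dimension_vadd]
    exact hdim
  · rw [hsum]
    exact ha

end Decompositions

section Attainment

variable {d : ℕ} {P : Set (Fin d → ℝ)}

lemma bddAbove_decompositionCountsOfDim (hP : Bornology.IsBounded P) (n : ℕ) (t : ℕ+) :
    BddAbove (decompositionCountsOfDim n ((t : ℝ) • P)) := by
  obtain ⟨C, hC⟩ := exists_card_le hP
  refine ⟨⌊C * t⌋₊, fun m hm => ?_⟩
  obtain ⟨s, rfl, hs⟩ := exists_packing_of_mem_decompositionCountsOfDim t.pos hm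
  exact Nat.le_floor (hC _ hs.fits hs.zero_notMem)

lemma IsPacking.card_le_nthMinkowskiLength {n : ℕ} {t : ℕ+} {s : Multiset (Fin d → ℤ)}
    (h : IsPacking n P (t, s)) (hP : Bornology.IsBounded P) :
    s.card ≤ nthMinkowskiLength n ((t : ℝ) • P) := by
  rcases s.card.eq_zero_or_pos with hs | hs
  · exact hs ▸ Nat.zero_le _
  · exact le_csSup (bddAbove_decompositionCountsOfDim hP n t)
      (h.card_mem_decompositionCountsOfDim hs)

lemma exists_packing_card_eq_nthMinkowskiLength (hP : IsLatticePolytope P) (hne : P.Nonempty)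
    (n : ℕ) (t : ℕ+) :
    ∃ s, s.card = nthMinkowskiLength n ((t : ℝ) • P) ∧ IsPacking n P (t, s) := by
  obtain ⟨p, hp⟩ := hP.exists_latticeEmb_mem hne
  have hempty : IsPacking n P (t, 0) := by
    refine ⟨t.pos, by simp, by simp [dimension_latticeZonotope_zero], (t : ℕ) • p, ?_⟩
    rw [latticeZonotope_zero, Set.vadd_set_singleton, Set.singleton_subset_iff, map_nsmul,
      vadd_eq_add, add_zero, ← Nat.cast_smul_eq_nsmul ℝ]
    exact Set.smul_mem_smul_set hp
  rcases (decompositionCountsOfDim n ((t : ℝ) • P)).eq_empty_or_nonempty with h | h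
  · exact ⟨0, by simp [nthMinkowskiLength, h], hempty⟩
  · exact exists_packing_of_mem_decompositionCountsOfDim t.pos
      (Nat.sSup_mem h (bddAbove_decompositionCountsOfDim hP.isBounded n t))

lemma nthMinkowskiLength_empty (n : ℕ) (t : ℕ+) :
    nthMinkowskiLength n ((t : ℝ) • (∅ : Set (Fin d → ℝ))) = 0 := by
  have hcounts : decompositionCountsOfDim n ((t : ℝ) • (∅ : Set (Fin d → ℝ))) = ∅ :=
    Set.eq_empty_of_forall_notMem fun m hm => by
      obtain ⟨s, -, hs⟩ := exists_packing_of_mem_decompositionCountsOfDim t.pos hm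
      exact hs.fits.nonempty.ne_empty rfl
  rw [nthMinkowskiLength, hcounts, csSup_empty]
  rfl

lemma exists_max_nthMinkowskiLength_div (n : ℕ) (hP : IsLatticePolytope P) :
    ∃ k : ℕ+, ∀ t : ℕ+, (nthMinkowskiLength n ((t : ℝ) • P) : ℝ) / (t : ℝ) ≤
      (nthMinkowskiLength n ((k : ℝ) • P) : ℝ) / (k : ℝ) := by
  rcases P.eq_empty_or_nonempty with rfl | hne
  · exact ⟨1, fun t => by simp only [nthMinkowskiLength_empty, Nat.cast_zero, zero_div, le_refl]⟩
  obtain ⟨⟨k, s⟩, hc, hmax⟩ := exists_max_ratio_packing hP hne n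
  lift k to ℕ+ using hc.pos
  refine ⟨k, fun t => ?_⟩
  obtain ⟨r, hr, hrt⟩ := exists_packing_card_eq_nthMinkowskiLength hP hne n t
  calc (nthMinkowskiLength n ((t : ℝ) • P) : ℝ) / t = ratio (t, r) := by rw [← hr, ratio]
    _ ≤ ratio (k, s) := hmax _ hrt
    _ ≤ (nthMinkowskiLength n ((k : ℝ) • P) : ℝ) / k := by
      unfold ratio
      gcongr
      exact hc.card_le_nthMinkowskiLength hP.isBounded

theorem nthRationalMinkowskiLength_attained (n : ℕ) (hP : IsLatticePolytope P) :
    (∀ t : ℕ+, BddAbove (decompositionCountsOfDim n ((t : ℝ) • P))) ∧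
      BddAbove (Set.range fun t : ℕ+ =>
        (nthMinkowskiLength n ((t : ℝ) • P) : ℝ) / (t : ℝ)) ∧
      (∃ k : ℕ+, nthRationalMinkowskiLength n P =
        (nthMinkowskiLength n ((k : ℝ) • P) : ℝ) / (k : ℝ)) ∧
      (∃ q : ℚ, nthRationalMinkowskiLength n P = (q : ℝ)) := by
  obtain ⟨k, hk⟩ := exists_max_nthMinkowskiLength_div n hP
  have hbdd : BddAbove (Set.range fun t : ℕ+ =>
      (nthMinkowskiLength n ((t : ℝ) • P) : ℝ) / (t : ℝ)) :=
    ⟨_, Set.forall_mem_range.2 hk⟩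
  have heq : nthRationalMinkowskiLength n P =
      (nthMinkowskiLength n ((k : ℝ) • P) : ℝ) / (k : ℝ) :=
    le_antisymm (ciSup_le hk) (le_ciSup hbdd k)
  refine ⟨bddAbove_decompositionCountsOfDim hP.isBounded n, hbdd, ⟨k, heq⟩,
    (nthMinkowskiLength n ((k : ℝ) • P) : ℚ) / ((k : ℕ) : ℚ), ?_⟩
  rw [heq]
  push_cast
  rfl

lemma decompositionCounts_eq (P : Set (Fin d → ℝ)) :
    decompositionCounts P = decompositionCountsOfDim d P := by
  have hdim (A : Set (Fin d → ℝ)) : dimension A ≤ d :=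
    (Submodule.finrank_le _).trans (by simp)
  simp only [decompositionCounts, decompositionCountsOfDim, hdim, true_and]

lemma minkowskiLength_eq (P : Set (Fin d → ℝ)) : minkowskiLength P = nthMinkowskiLength d P := by
  rw [minkowskiLength, decompositionCounts_eq, nthMinkowskiLength]

lemma rationalMinkowskiLength_eq (P : Set (Fin d → ℝ)) :
    rationalMinkowskiLength P = nthRationalMinkowskiLength d P := by
  simp only [rationalMinkowskiLength, minkowskiLength_eq, nthRationalMinkowskiLength]

end Attainment

end MinkowskiLength

theorem theoremT (d : ℕ) (P : Set (Fin d → ℝ)) (hP : MinkowskiLength.IsLatticePolytope P) :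
    -- the numbers `L(tP)` and `λ(P)` are suprema of sets that are bounded above
    ((∀ t : ℕ+, BddAbove (MinkowskiLength.decompositionCounts ((t : ℝ) • P))) ∧
      BddAbove (Set.range fun t : ℕ+ =>
        (MinkowskiLength.minkowskiLength ((t : ℝ) • P) : ℝ) / (t : ℝ)) ∧
      -- `λ(P)` is attained, and rational
      (∃ k : ℕ+, MinkowskiLength.rationalMinkowskiLength P =
        (MinkowskiLength.minkowskiLength ((k : ℝ) • P) : ℝ) / (k : ℝ)) ∧
      (∃ q : ℚ, MinkowskiLength.rationalMinkowskiLength P = (q : ℝ))) ∧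
    -- the same for `L_n(tP)` and `λ_n(P)`
    (∀ n : ℕ, 1 ≤ n → n ≤ d →
      (∀ t : ℕ+, BddAbove (MinkowskiLength.decompositionCountsOfDim n ((t : ℝ) • P))) ∧
      BddAbove (Set.range fun t : ℕ+ =>
        (MinkowskiLength.nthMinkowskiLength n ((t : ℝ) • P) : ℝ) / (t : ℝ)) ∧
      (∃ k : ℕ+, MinkowskiLength.nthRationalMinkowskiLength n P =
        (MinkowskiLength.nthMinkowskiLength n ((k : ℝ) • P) : ℝ) / (k : ℝ)) ∧
      (∃ q : ℚ, MinkowskiLength.nthRationalMinkowskiLength n P = (q : ℝ))) := by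
  refine ⟨?_, fun n _ _ => MinkowskiLength.nthRationalMinkowskiLength_attained n hP⟩
  simp only [MinkowskiLength.decompositionCounts_eq, MinkowskiLength.minkowskiLength_eq,
    MinkowskiLength.rationalMinkowskiLength_eq]
  exact MinkowskiLength.nthRationalMinkowskiLength_attained d hP
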